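/- A skew brace $(G,\cdot,\circ)$ is a set $G$ with two group structures such that $a\circ(b\cdot c)=(a\circ b)\cdot a^{-1}\cdot(a\circ c)$ for all $a,b,c\in G$, where $a^{-1}$ is the inverse in $(G,\cdot)$; the group $(G,\cdot)$ is called its additive group. A sub-skew brace is a subset that is a subgroup of both $(G,\cdot)$ and $(G,\circ)$. A skew brace is cyclic if its additive group is cyclic, and it is minimal non-cyclic if it is not cyclic but all its proper sub-skew braces are cyclic. A Z-group is a finite group all of whose Sylow subgroups are cyclic. Let $(G,\cdot,\circ)$ be a finite minimal non-cyclic skew brace of odd order $|G|=p^{\alpha}m$, where $p$ is the smallest prime divisor of $|G|$, $\alpha\ge 1$ and $p\nmid m$ (so $p>2$ and every prime divisor of $m$ is greater than $p$). Suppose that the group $(G,\cdot)$ is neither nilpotent nor perfect. Then one of the following holds. (1) The group $(G,\circ)$ is nilpotent, and $(G,\circ)\cong C_m\times Q$, where $C_m$ is the cyclic group of order $m$ and $Q$ is a $p$-group that has a cyclic maximal subgroup. (2) The group $(G,\circ)$ is not nilpotent, and $(G,\circ)\cong K\rtimes Q$, where $K$ is a Z-group of order $m$ and $Q$ is a $p$-group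 that has a cyclic maximal subgroup. -/

import Mathlib

universe u

/-- A skew brace structure on a group `G`. The given group structure of `G` is the additive group
`(G, ·)`; `circGroup` is a second group structure on the same set, the multiplicative group
`(G, ∘)`, and the two satisfy `a ∘ (b · c) = (a ∘ b) · a⁻¹ · (a ∘ c)`, where the inverse is taken
in `(G, ·)`. The operations are written as `dot.mul`, `dot.inv` and `circGroup.mul` so that it is
explicit which group structure is meant. -/
class SkewBrace (G : Type u) [dot : Group G] where
  circGroup : Group G
  circ_mul : ∀ a b c : G,
    circGroup.mul a (dot.mul b c) =
      dot.mul (dot.mul (circGroup.mul a b) (dot.inv a)) (circGroup.mul a c)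

namespace SkewBrace

/-- The set `G`, to be regarded as the multiplicative group `(G, ∘)` of the skew brace. -/
def Circ (G : Type u) [Group G] [SkewBrace G] : Type u := G

instance (G : Type u) [Group G] [SkewBrace G] : Group (Circ G) :=
  (SkewBrace.circGroup : Group G)

/-- The identity map from `(G, ·)` to `(G, ∘)`, as a bijection of sets. -/
def toCirc (G : Type u) [Group G] [SkewBrace G] : G ≃ Circ G := Equiv.refl G

/-- The skew brace law in ordinary notation: `*` and `⁻¹` on `G` are those of `(G, ·)`, and `*` on
`Circ G` is `∘`. -/
theorem toCirc_mul_toCirc_mul (G : Type u) [Group G] [SkewBrace G] (a b c : G) :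
    (toCirc G).symm (toCirc G a * toCirc G (b * c)) =
      (toCirc G).symm (toCirc G a * toCirc G b) * a⁻¹ *
        (toCirc G).symm (toCirc G a * toCirc G c) :=
  SkewBrace.circ_mul a b c

/-- A subgroup `S` of `(G, ·)` is a sub-skew brace if the same set is a subgroup of `(G, ∘)`. -/
def IsSubSkewBrace {G : Type u} [Group G] [SkewBrace G] (S : Subgroup G) : Prop :=
  ∃ T : Subgroup (Circ G), ∀ x : G, toCirc G x ∈ T ↔ x ∈ S

/-- A skew brace, with additive group `G`, is minimal non-cyclic if it is not cyclic (that is, its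
additive group is not cyclic), but all its proper sub-skew braces are cyclic. -/
def IsMinimalNonCyclic (G : Type u) [Group G] [SkewBrace G] : Prop :=
  ¬ IsCyclic G ∧ ∀ S : Subgroup G, IsSubSkewBrace S → S ≠ ⊤ → IsCyclic S

end SkewBrace

/-- `Q` has a maximal subgroup that is cyclic. -/
def HasCyclicMaximalSubgroup (Q : Type u) [Group Q] : Prop :=
  ∃ C : Subgroup Q, IsCoatom C ∧ IsCyclic C

/-! Each `a` acts on `(G, ·)` by the automorphism `lambda a`, so every characteristic subgroup of
`(G, ·)` is a sub-skew brace, and by minimality it is cyclic if proper. Since `G` is not perfect,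
its commutator subgroup is cyclic, and a transfer argument makes the `p'`-elements a characteristic
subgroup `K` of order `m`, cyclic because `α > 0`. Since `G` is not nilpotent, some Sylow subgroup
`S` of `K` is not central; its centralizer `L` is cyclic and contains `K`, and minimality forces
index `p`.

These facts pass to `(G, ∘)`. A geometric-sum computation shows that a cyclic characteristic
subgroup of odd prime power order stays cyclic under `∘`; so `K` becomes a Z-group, and the `p`-part
of `L` a cyclic maximal subgroup of a Sylow `p`-subgroup `Q`. For `g` in `K`, `lambda g` has order
dividing `m` and so acts trivially on the `p`-group `G / K`, which has the cyclic subgroup `L / K`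
of index `p`. Hence `K` is normal for `∘`, with complement `Q`. In the nilpotent case `Q` is normal
too, and a nilpotent Z-group is cyclic. -/

/-! ### Coprime action on cyclic `p`-groups. -/

theorem Nat.Prime.coprime_totient_pow_of_forall_lt {p n : ℕ} (hp : p.Prime)
    (hn : ∀ q : ℕ, q.Prime → q ∣ n → p < q) (k : ℕ) :
    n.Coprime (Nat.totient (p ^ k)) := by
  have hnp : n.Coprime p :=
    Nat.Coprime.symm ((Nat.Prime.coprime_iff_not_dvd hp).2 fun h => lt_irrefl _ (hn p hp h))
  rcases Nat.eq_zero_or_pos k with rfl | hk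
  · simp
  rw [Nat.totient_prime_pow hp hk]
  refine Nat.Coprime.mul_right (hnp.pow_right _) (Nat.Coprime.symm ?_)
  refine Nat.coprime_of_dvd fun q hq h1 h2 => ?_
  have := Nat.le_of_dvd (Nat.sub_pos_of_lt hp.one_lt) h1
  have := hn q hq h2
  omega

/-- If `u ^ n ≡ 1` modulo a power of `p` and all primes dividing `n` exceed `p`, then `u ≡ 1`. -/
theorem Nat.modEq_one_of_pow_modEq_one {p n k u : ℕ} (hp : p.Prime)
    (hn : ∀ q : ℕ, q.Prime → q ∣ n → p < q) (hn0 : n ≠ 0) (h : u ^ n ≡ 1 [MOD p ^ k]) :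
    u ≡ 1 [MOD p ^ k] := by
  have h' : (u : ZMod (p ^ k)) ^ n = 1 := by
    have := (ZMod.natCast_eq_natCast_iff _ _ _).2 h
    simpa using this
  have : NeZero (p ^ k) := ⟨pow_ne_zero _ hp.ne_zero⟩
  let v : (ZMod (p ^ k))ˣ := Units.ofPowEqOne _ n h' hn0
  have hv : v ^ n = 1 := Units.pow_ofPowEqOne h' hn0
  have h1 : orderOf v ∣ n := orderOf_dvd_of_pow_eq_one hv
  have h2 : orderOf v ∣ Nat.totient (p ^ k) := by
    have := orderOf_dvd_card (x := v)
    rwa [ZMod.card_units_eq_totient] at this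
  have h3 : orderOf v = 1 :=
    Nat.eq_one_of_dvd_coprimes (Nat.Prime.coprime_totient_pow_of_forall_lt hp hn k) h1 h2
  have h4 : (v : ZMod (p ^ k)) = 1 := by rw [orderOf_eq_one_iff.1 h3]; rfl
  have h5 : (u : ZMod (p ^ k)) = 1 := h4
  apply (ZMod.natCast_eq_natCast_iff _ _ _).1
  simpa using h5

theorem MonoidHom.iterate_eq_pow {G : Type*} [Group G] (σ : G →* G) {x : G} {u : ℕ}
    (h : σ x = x ^ u) (n : ℕ) : σ^[n] x = x ^ u ^ n := by
  induction n with
  | zero => simp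
  | succ n ih => rw [Function.iterate_succ_apply', ih, map_pow, h, ← pow_mul, pow_succ']

/-- An endomorphism of coprime order fixes every `p`-element whose cyclic span it preserves. -/
theorem MonoidHom.apply_eq_self_of_mem_zpowers {G : Type*} [Group G] {p n k : ℕ} (hp : p.Prime)
    (hn : ∀ q : ℕ, q.Prime → q ∣ n → p < q) (hn0 : n ≠ 0) (σ : G →* G) {x : G}
    (hx : orderOf x = p ^ k) (hσ : σ x ∈ Subgroup.zpowers x) (hσn : σ^[n] x = x) : σ x = x := by
  have hfin : IsOfFinOrder x := by
    rw [← orderOf_pos_iff, hx]; exact pow_pos hp.pos _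
  obtain ⟨u, hu⟩ := hfin.mem_powers_iff_mem_zpowers.2 hσ
  have hu : x ^ u = σ x := hu
  have h1 : x ^ u ^ n = x ^ 1 := by rw [← MonoidHom.iterate_eq_pow σ hu.symm, hσn, pow_one]
  rw [pow_eq_pow_iff_modEq, hx] at h1
  have h2 := Nat.modEq_one_of_pow_modEq_one hp hn hn0 h1
  rw [← hx, ← pow_eq_pow_iff_modEq, hu, pow_one] at h2
  exact h2

theorem Subgroup.conj_mem_zpowers_of_isCyclic {G : Type*} [Group G] [Finite G]
    (D : Subgroup G) [D.Normal] [IsCyclic D] {x : G} (hx : x ∈ D) (g : G) :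
    g * x * g⁻¹ ∈ Subgroup.zpowers x := by
  obtain ⟨m, hm⟩ := MonoidHom.map_cyclic (MulAut.conjNormal g : MulAut D).toMonoidHom
  have := congrArg Subtype.val (hm ⟨x, hx⟩)
  simp at this
  exact ⟨m, this.symm⟩

theorem MulAut.conj_iterate_apply {G : Type*} [Group G] (g x : G) (n : ℕ) :
    (MulAut.conj g).toMonoidHom^[n] x = g ^ n * x * (g ^ n)⁻¹ := by
  induction n with
  | zero => simp
  | succ n ih =>
    rw [Function.iterate_succ_apply', ih]
    simp [pow_succ', mul_assoc]

theorem Nat.Prime.coprime_of_forall_lt {p m : ℕ} (hp : p.Prime)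
    (hm : ∀ q : ℕ, q.Prime → q ∣ m → p < q) : p.Coprime m :=
  (Nat.Prime.coprime_iff_not_dvd hp).2 fun h => lt_irrefl _ (hm p hp h)

/-! ### The normal Hall `p'`-subgroup of the additive group. -/

section

variable {G : Type*} [Group G] [Finite G] {p α m : ℕ}

/-- If the commutator subgroup is cyclic and `p` is the smallest prime divisor of the group order,
the elements of order prime to `p` are closed under multiplication. -/
theorem mul_pow_eq_one_of_isCyclic_commutator [IsCyclic (commutator G)] (hp : p.Prime)
    (hm : ∀ q : ℕ, q.Prime → q ∣ m → p < q) (hcard : Nat.card G = p ^ α * m)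
    {x y : G} (hx : x ^ m = 1) (hy : y ^ m = 1) : (x * y) ^ m = 1 := by
  have hm0 : m ≠ 0 := by
    rintro rfl; exact Nat.card_pos.ne' (by simpa using hcard)
  have hpm := hp.coprime_of_forall_lt hm
  -- `H` is the preimage of the `m`-torsion of the abelianization. It contains `x` and `y`, and its
  -- `p`-elements lie in the commutator subgroup.
  let H : Subgroup G := ((powMonoidHom m).comp (Abelianization.of (G := G))).ker
  have hH : ∀ g, g ∈ H ↔ g ^ m ∈ commutator G := by
    intro g
    simp only [H, MonoidHom.mem_ker, MonoidHom.comp_apply, powMonoidHom_apply, ← map_pow]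
    rw [← MonoidHom.mem_ker, Abelianization.ker_of]
  have hcen : ∀ h ∈ H, ∀ g ∈ H, ∀ k, orderOf g = p ^ k → h * g * h⁻¹ = g := by
    intro h hh g hg k hk
    have hgD : g ∈ commutator G := by
      have h1 : g ^ m ∈ commutator G := (hH g).1 hg
      have h2 : (g ^ m) ∈ Subgroup.zpowers g := ⟨m, by simp⟩
      have h3 : g ∈ Subgroup.zpowers (g ^ m) := by
        have hc : (orderOf g).Coprime m := by rw [hk]; exact hpm.pow_left _
        obtain ⟨j, hj⟩ := exists_pow_eq_self_of_coprime hc.symm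
        exact ⟨j, by simpa using hj⟩
      exact Subgroup.zpowers_le.2 h1 h3
    refine MonoidHom.apply_eq_self_of_mem_zpowers hp hm hm0 (MulAut.conj h).toMonoidHom hk ?_ ?_
    · exact Subgroup.conj_mem_zpowers_of_isCyclic _ hgD h
    · rw [MulAut.conj_iterate_apply]
      have hc : h ^ m * g = g * h ^ m := by
        have := IsMulCommutative.is_comm.comm (⟨h ^ m, (hH h).1 hh⟩ : commutator G) ⟨g, hgD⟩
        exact congrArg Subtype.val this
      rw [hc]; group
  have : Fact p.Prime := ⟨hp⟩
  -- By `hcen` a Sylow `p`-subgroup of `H` is central in `H`.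
  have hidx : ¬ p ∣ (Subgroup.center H).index := by
    obtain ⟨P⟩ : Nonempty (Sylow p H) := inferInstance
    have hle : (P : Subgroup H) ≤ Subgroup.center H := by
      intro g hg
      obtain ⟨k, hk⟩ := (IsPGroup.iff_orderOf.1 P.isPGroup') ⟨g, hg⟩
      rw [Subgroup.mem_center_iff]
      intro h
      have hk' : orderOf (g : G) = p ^ k := by
        rw [← hk, Subgroup.orderOf_coe, ← Subgroup.orderOf_coe ⟨g, hg⟩]
      have := hcen h h.2 g g.2 k hk'
      apply Subtype.ext
      exact mul_inv_eq_iff_eq_mul.1 this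
    exact fun h => P.not_dvd_index (h.trans (Subgroup.index_dvd_of_le hle))
  have hdvd : (Subgroup.center H).index ∣ m := by
    have h1 : (Subgroup.center H).index ∣ p ^ α * m := by
      rw [← hcard]
      exact (Subgroup.index_dvd_card _).trans (Subgroup.card_subgroup_dvd_card H)
    refine Nat.Coprime.dvd_of_dvd_mul_left ?_ h1
    exact (((Nat.Prime.coprime_iff_not_dvd hp).2 hidx).pow_left _).symm
  obtain ⟨j, hj⟩ := hdvd
  have hxH : x ∈ H := by rw [hH, hx]; exact one_mem _
  have hyH : y ∈ H := by rw [hH, hy]; exact one_mem _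
  -- The transfer to the center is the power map with exponent the index of the center, which is
  -- thus a homomorphism; raising to the `j` gives the exponent `m`.
  have key : ∀ a : H, ((MonoidHom.transferCenterPow H a : H) : G) ^ j = (a : G) ^ m := by
    intro a
    rw [MonoidHom.transferCenterPow_apply, hj, pow_mul]; rfl
  have h1 := key (⟨x, hxH⟩ * ⟨y, hyH⟩)
  rw [map_mul] at h1
  have hcomm : Commute ((MonoidHom.transferCenterPow H ⟨x, hxH⟩ : H) : G)
      ((MonoidHom.transferCenterPow H ⟨y, hyH⟩ : H) : G) :=
    congrArg Subtype.val (Subgroup.mem_center_iff.1 (MonoidHom.transferCenterPow H ⟨y, hyH⟩).2 _)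
  have h2 : (((MonoidHom.transferCenterPow H ⟨x, hxH⟩ : H) : G) *
      ((MonoidHom.transferCenterPow H ⟨y, hyH⟩ : H) : G)) ^ j = (x * y) ^ m := h1
  rw [← h2, hcomm.mul_pow, key, key]
  simp [hx, hy]

/-- The normal Hall `p'`-subgroup, as the set of solutions of `x ^ m = 1`. -/
theorem exists_hall_of_isCyclic_commutator [IsCyclic (commutator G)] (hp : p.Prime)
    (hm : ∀ q : ℕ, q.Prime → q ∣ m → p < q) (hcard : Nat.card G = p ^ α * m) :
    ∃ K : Subgroup G, K.Characteristic ∧ Nat.card K = m ∧ K.index = p ^ α := by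
  have hpm := hp.coprime_of_forall_lt hm
  have : Fact p.Prime := ⟨hp⟩
  let K : Subgroup G :=
    { carrier := {x | x ^ m = 1}
      mul_mem' := fun hx hy => mul_pow_eq_one_of_isCyclic_commutator hp hm hcard hx hy
      one_mem' := one_pow m
      inv_mem' := fun {x} (hx : x ^ m = 1) => by simp [hx] }
  have hK : ∀ x, x ∈ K ↔ x ^ m = 1 := fun x => Iff.rfl
  have hchar : K.Characteristic := by
    rw [Subgroup.characteristic_iff_le_comap]
    intro φ x hx
    rw [hK] at hx
    rw [Subgroup.mem_comap, hK, ← map_pow, hx, map_one]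
  have h1 : ¬ p ∣ Nat.card K := by
    intro h
    obtain ⟨x, hx⟩ := exists_prime_orderOf_dvd_card' p h
    have hxm : x ^ m = 1 := Subtype.ext ((hK _).1 x.2)
    have := orderOf_dvd_of_pow_eq_one hxm
    rw [hx] at this
    exact lt_irrefl _ (hm p hp this)
  have h2 : IsPGroup p (G ⧸ K) := by
    intro y
    induction y using QuotientGroup.induction_on with
    | H x =>
      refine ⟨α, ?_⟩
      rw [← QuotientGroup.mk_pow, QuotientGroup.eq_one_iff, hK, ← pow_mul, ← hcard,
        pow_card_eq_one']
  obtain ⟨j, hj⟩ := IsPGroup.iff_card.1 h2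
  have h3 : Nat.card K * p ^ j = p ^ α * m := by
    rw [← hj, ← hcard]; exact K.card_mul_index
  have h4 : Nat.card K = m := by
    have hc := (Nat.Prime.coprime_iff_not_dvd hp).2 h1
    apply Nat.dvd_antisymm
    · exact (hc.symm.pow_right α).dvd_of_dvd_mul_left (h3 ▸ dvd_mul_right _ _)
    · refine ((hpm.symm).pow_right j).dvd_of_dvd_mul_right ?_
      rw [h3]; exact dvd_mul_left _ _
  refine ⟨K, hchar, h4, ?_⟩
  have h5 := K.card_mul_index
  rw [hcard, h4, mul_comm] at h5
  have hm0 : m ≠ 0 := by rw [← h4]; exact Nat.card_pos.ne'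
  exact Nat.eq_of_mul_eq_mul_right (Nat.pos_of_ne_zero hm0) h5

end

/-! ### A characteristic cyclic subgroup of index `p`. -/

theorem Subgroup.characteristic_map_sylow {G : Type*} [Group G] [Finite G] (L : Subgroup G)
    [L.Characteristic] [IsCyclic L] {r : ℕ} [Fact r.Prime] (T : Sylow r L) :
    ((T : Subgroup L).map L.subtype).Characteristic := by
  have : (T : Subgroup L).Characteristic := T.characteristic_of_normal inferInstance
  infer_instance

theorem Subgroup.eq_top_of_forall_sylow_le {G : Type*} [Group G] [Finite G] (Z : Subgroup G)
    (h : ∀ q : ℕ, q.Prime → ∀ T : Sylow q G, (T : Subgroup G) ≤ Z) : Z = ⊤ := by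
  by_contra hZ
  have h1 : Z.index ≠ 1 := fun h => hZ (Subgroup.index_eq_one.1 h)
  obtain ⟨q, hq, hqd⟩ := Nat.exists_prime_and_dvd h1
  have : Fact q.Prime := ⟨hq⟩
  obtain ⟨T⟩ : Nonempty (Sylow q G) := inferInstance
  exact T.not_dvd_index (hqd.trans (Subgroup.index_dvd_of_le (h q hq T)))

theorem IsCyclic.mulAut_of_odd_prime_pow {S : Type*} [Group S] [IsCyclic S] {q k : ℕ}
    (hq : q.Prime) (hq2 : q ≠ 2) (hS : Nat.card S = q ^ k) : IsCyclic (MulAut S) := by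
  have : IsCyclic (ZMod (Nat.card S))ˣ := by
    rw [hS]; exact ZMod.isCyclic_units_of_prime_pow q hq hq2 k
  exact isCyclic_of_surjective (IsCyclic.mulAutMulEquiv S).symm.toMonoidHom
    (IsCyclic.mulAutMulEquiv S).symm.surjective

/-- If every proper characteristic subgroup is cyclic and a cyclic normal Hall `p'`-subgroup `K` is
not a direct factor, then some cyclic characteristic subgroup containing `K` has index `p`. -/
theorem exists_isCyclic_characteristic_index_eq {G : Type*} [Group G] [Finite G] {p α : ℕ}
    (hp : p.Prime) (hmin : ∀ S : Subgroup G, S.Characteristic → S ≠ ⊤ → IsCyclic S)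
    (hnil : ¬ Group.IsNilpotent G) (K : Subgroup G) [K.Characteristic] [IsCyclic K]
    (hKm : ∀ q : ℕ, q.Prime → q ∣ Nat.card K → p < q) (hK : K.index = p ^ α) :
    ∃ L : Subgroup G, L.Characteristic ∧ IsCyclic L ∧ K ≤ L ∧ L.index = p := by
  have : Fact p.Prime := ⟨hp⟩
  obtain ⟨q, hq, T, hT⟩ : ∃ q : ℕ, q.Prime ∧ ∃ T : Sylow q K,
      ¬ (T : Subgroup K) ≤ (Subgroup.center G).subgroupOf K := by
    -- Otherwise `K` is central with `G / K` a `p`-group, and `G` is nilpotent.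
    by_contra! hcon
    have htop := Subgroup.eq_top_of_forall_sylow_le _ hcon
    rw [Subgroup.subgroupOf_eq_top] at htop
    have hpg : IsPGroup p (G ⧸ K) := IsPGroup.of_card hK
    have : Group.IsNilpotent (G ⧸ K) := hpg.isNilpotent
    exact hnil (Subgroup.isNilpotent_of_ker_le_center (QuotientGroup.mk' K)
      (by rwa [QuotientGroup.ker_mk']))
  have : Fact q.Prime := ⟨hq⟩
  have hSchar := K.characteristic_map_sylow T
  set S : Subgroup G := (T : Subgroup K).map K.subtype with hS
  have hSK : S ≤ K := Subgroup.map_subtype_le _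
  have hSc : ¬ S ≤ Subgroup.center G := by
    intro h; apply hT
    intro x hx
    exact h ⟨x, hx, rfl⟩
  have hcardS : Nat.card S = Nat.card T :=
    Nat.card_congr ((T : Subgroup K).equivMapOfInjective K.subtype K.subtype_injective).symm.toEquiv
  obtain ⟨a, ha⟩ := IsPGroup.iff_card.1 T.isPGroup'
  have ha' : Nat.card S = q ^ a := hcardS.trans ha
  have ha0 : a ≠ 0 := by
    rintro rfl
    apply hSc
    rw [Subgroup.card_eq_one.1 ((by simpa using ha') : Nat.card S = 1)]
    exact bot_le
  have hpq : p < q := hKm q hq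
    ((dvd_pow_self q ha0).trans (ha' ▸ Subgroup.card_dvd_of_le hSK))
  have hKcomm : ∀ x ∈ K, ∀ y ∈ K, x * y = y * x := fun x hx y hy =>
    congrArg Subtype.val (IsMulCommutative.is_comm.comm (⟨x, hx⟩ : K) ⟨y, hy⟩)
  have hScyc : IsCyclic S :=
    isCyclic_of_injective (Subgroup.inclusion hSK) (Subgroup.inclusion_injective hSK)
  have hAut : IsCyclic (MulAut S) := IsCyclic.mulAut_of_odd_prime_pow hq
    (by have := hp.two_le; omega) ha'
  let σ : G →* MulAut S := MulAut.conjNormal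
  have hker : ∀ g, g ∈ Subgroup.centralizer (S : Set G) ↔ σ g = 1 := by
    intro g
    rw [Subgroup.mem_centralizer_iff]
    constructor
    · intro h
      ext x
      simp [σ, ← h x x.2]
    · intro h x hx
      have h1 : ((σ g) ⟨x, hx⟩ : G) = x := by rw [h]; rfl
      simp only [σ, MulAut.conjNormal_apply] at h1
      exact (mul_inv_eq_iff_eq_mul.1 h1).symm
  have hker' : σ.ker = Subgroup.centralizer (S : Set G) := by
    ext g; rw [hker, MonoidHom.mem_ker]
  have hLchar : (Subgroup.centralizer (S : Set G)).Characteristic := inferInstance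
  have hLtop : Subgroup.centralizer (S : Set G) ≠ ⊤ := by
    intro h
    exact hSc (Subgroup.centralizer_eq_top_iff_subset.1 h)
  have hKL : K ≤ Subgroup.centralizer (S : Set G) := by
    intro x hx
    rw [Subgroup.mem_centralizer_iff]
    exact fun y hy => hKcomm y (hSK hy) x hx
  refine ⟨Subgroup.centralizer (S : Set G), hLchar, hmin _ hLchar hLtop, hKL, ?_⟩
  obtain ⟨k, -, hk⟩ := (Nat.dvd_prime_pow hp).1 (hK ▸ Subgroup.index_dvd_of_le hKL)
  have hk0 : k ≠ 0 := by
    rintro rfl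
    exact hLtop (Subgroup.index_eq_one.1 (by simpa using hk))
  obtain ⟨j, rfl⟩ := Nat.exists_eq_succ_of_ne_zero hk0
  have hrange : Nat.card σ.range = p ^ (j + 1) := by
    rw [← hk, ← hker', Subgroup.index_ker]
  obtain ⟨⟨_, x, rfl⟩, hx⟩ := IsCyclic.exists_ofOrder_eq_natCard (α := σ.range)
  rw [hrange, ← Subgroup.orderOf_coe] at hx
  change orderOf (σ x) = _ at hx
  -- `σ.range` is cyclic of order `p ^ (j + 1)`, and `U` is the preimage of its subgroup of order `p
  -- ^ j`. Being proper and characteristic, `U` is cyclic; it contains `S`, hence centralizes it. As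
  -- `x ^ p` is in `U`, this forces `j = 0`.
  let U : Subgroup G :=
    { carrier := {g | σ g ^ p ^ j = 1}
      mul_mem' := by
        intro g h (hg : _ = _) (hh : _ = _)
        have hc : Commute (σ g) (σ h) := IsMulCommutative.is_comm.comm _ _
        change σ (g * h) ^ p ^ j = 1
        rw [map_mul, hc.mul_pow, hg, hh, one_mul]
      one_mem' := by simp
      inv_mem' := by
        intro g (hg : _ = _)
        change σ g⁻¹ ^ p ^ j = 1
        rw [map_inv, inv_pow, hg, inv_one] }
  have hU : ∀ g, g ∈ U ↔ σ g ^ p ^ j = 1 := fun g => Iff.rfl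
  have hUchar : U.Characteristic := by
    rw [Subgroup.characteristic_iff_le_comap] at hLchar ⊢
    intro φ g hg
    rw [hU, ← map_pow, ← hker] at hg
    have := hLchar φ hg
    rw [Subgroup.mem_comap, map_pow, hker, map_pow] at this
    exact this
  have hUtop : U ≠ ⊤ := by
    intro h
    have h1 : x ∈ U := h ▸ Subgroup.mem_top x
    rw [hU] at h1
    have h2 := orderOf_dvd_of_pow_eq_one h1
    rw [hx, Nat.pow_dvd_pow_iff_le_right hp.one_lt] at h2
    omega
  have hUcyc := hmin U hUchar hUtop
  have hUL : U ≤ Subgroup.centralizer (S : Set G) := by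
    intro u hu
    rw [Subgroup.mem_centralizer_iff]
    intro s hs
    have hsU : s ∈ U := by rw [hU, (hker s).1 (hKL (hSK hs)), one_pow]
    exact congrArg Subtype.val (IsMulCommutative.is_comm.comm (⟨s, hsU⟩ : U) ⟨u, hu⟩)
  have hxp : x ^ p ∈ U := by
    rw [hU, map_pow, ← pow_mul, ← pow_succ', ← hx, pow_orderOf_eq_one]
  have h3 := (hker _).1 (hUL hxp)
  rw [map_pow] at h3
  have h4 := orderOf_dvd_of_pow_eq_one h3
  rw [hx] at h4
  have h5 : j + 1 ≤ 1 := (Nat.pow_dvd_pow_iff_le_right hp.one_lt).1 (by simpa using h4)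
  obtain rfl : j = 0 := by omega
  simpa using hk

/-! ### Coprime action on `p`-groups with a cyclic subgroup of index `p`. -/

/-- A cyclic group maps each cyclic subgroup into itself under every endomorphism. -/
theorem MonoidHom.apply_mem_zpowers_of_isCyclic {N : Type*} [Group N] [IsCyclic N] (σ : N →* N)
    (x : N) : σ x ∈ Subgroup.zpowers x := by
  obtain ⟨m, hm⟩ := σ.map_cyclic
  exact ⟨m, (hm x).symm⟩

theorem IsPGroup.eq_one_of_pow_eq_one {G : Type*} [Group G] {p n : ℕ} [Fact p.Prime]
    (h : IsPGroup p G)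
    (hpn : p.Coprime n) {x : G} (hx : x ^ n = 1) : x = 1 := by
  obtain ⟨k, hk⟩ := IsPGroup.iff_orderOf.1 h x
  rw [← orderOf_eq_one_iff]
  have h1 := orderOf_dvd_of_pow_eq_one hx
  exact Nat.eq_one_of_dvd_coprimes (hpn.pow_left k) (hk ▸ dvd_rfl) h1

/-- A `p'`-endomorphism, of order with all prime divisors above `p`, acts trivially on a `p`-group
with an invariant cyclic subgroup of index `p`. -/
theorem IsPGroup.endomorphism_eq_self {G : Type*} [Group G] [Finite G] {p n : ℕ} (hp : p.Prime)
    (hn : ∀ q : ℕ, q.Prime → q ∣ n → p < q) (hn0 : n ≠ 0) (hG : IsPGroup p G)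
    (N : Subgroup G) [N.Normal] [IsCyclic N] (hN : N.index = p) (σ : G →* G)
    (hσN : N ≤ N.comap σ) (hσ : ∀ x, σ^[n] x = x) (x : G) : σ x = x := by
  have : Fact p.Prime := ⟨hp⟩
  have hfixN : ∀ y ∈ N, σ y = y := by
    intro y hy
    obtain ⟨k, hk⟩ := IsPGroup.iff_orderOf.1 hG y
    refine MonoidHom.apply_eq_self_of_mem_zpowers hp hn hn0 σ hk ?_ (hσ y)
    obtain ⟨z, hz⟩ := MonoidHom.apply_mem_zpowers_of_isCyclic
      ((σ.comp N.subtype).codRestrict N fun w => hσN w.2) ⟨y, hy⟩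
    exact ⟨z, congrArg Subtype.val hz⟩
  have hquot : (QuotientGroup.mk (σ x) : G ⧸ N) = QuotientGroup.mk x := by
    have hc : IsCyclic (G ⧸ N) := isCyclic_of_prime_card (p := p) hN
    obtain ⟨k, hk⟩ := IsPGroup.iff_orderOf.1 (hG.to_quotient N) (QuotientGroup.mk x)
    refine MonoidHom.apply_eq_self_of_mem_zpowers hp hn hn0 (QuotientGroup.map N N σ hσN) hk
      (MonoidHom.apply_mem_zpowers_of_isCyclic _ _) ?_
    have hs : Function.Semiconj (QuotientGroup.mk : G → G ⧸ N) σ (QuotientGroup.map N N σ hσN) :=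
      fun y => rfl
    rw [← (hs.iterate_right n).eq, hσ]
  have hl : x⁻¹ * σ x ∈ N := QuotientGroup.eq.1 hquot.symm
  -- `x⁻¹ * σ x` lies in `N`, so `σ` fixes it; taking `j = n` shows that its `n`-th power is
  -- trivial.
  have hit : ∀ j : ℕ, σ^[j] x = x * (x⁻¹ * σ x) ^ j := by
    intro j
    induction j with
    | zero => simp
    | succ j ih =>
      rw [Function.iterate_succ_apply', ih, map_mul, map_pow, hfixN _ hl, pow_succ', ← mul_assoc,
        ← mul_assoc, mul_inv_cancel, one_mul]
  have h1 : (x⁻¹ * σ x) ^ n = 1 := by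
    have := hit n
    rw [hσ] at this
    exact left_eq_mul.1 this
  have h2 := hG.eq_one_of_pow_eq_one (hp.coprime_of_forall_lt hn) h1
  exact (inv_mul_eq_one.1 h2).symm

/-- This is `IsPGroup.endomorphism_eq_self` for `G ⧸ K` and the image of `L`. -/
theorem inv_mul_apply_mem_of_isCyclic {G : Type*} [Group G] [Finite G] {p n α : ℕ} (hp : p.Prime)
    (hn : ∀ q : ℕ, q.Prime → q ∣ n → p < q) (hn0 : n ≠ 0) (K L : Subgroup G) [K.Normal]
    [L.Normal] [IsCyclic L] (hKL : K ≤ L) (hK : K.index = p ^ α) (hL : L.index = p) (σ : G →* G)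
    (hσK : K ≤ K.comap σ) (hσL : L ≤ L.comap σ) (hσ : ∀ x, σ^[n] x = x) (x : G) :
    x⁻¹ * σ x ∈ K := by
  have : Fact p.Prime := ⟨hp⟩
  have hsurj := QuotientGroup.mk'_surjective K
  have : (L.map (QuotientGroup.mk' K)).Normal := Subgroup.Normal.map inferInstance _ hsurj
  have : IsCyclic (L.map (QuotientGroup.mk' K)) :=
    isCyclic_of_surjective ((QuotientGroup.mk' K).subgroupMap L)
      ((QuotientGroup.mk' K).subgroupMap_surjective L)
  have hidx : (L.map (QuotientGroup.mk' K)).index = p := by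
    rw [Subgroup.index_map_eq _ hsurj (by rwa [QuotientGroup.ker_mk']), hL]
  have hs : Function.Semiconj (QuotientGroup.mk : G → G ⧸ K) σ (QuotientGroup.map K K σ hσK) :=
    fun y => rfl
  refine QuotientGroup.eq.1 (Eq.symm (IsPGroup.endomorphism_eq_self hp hn hn0
    (IsPGroup.of_card hK) _ hidx (QuotientGroup.map K K σ hσK) ?_ ?_ (QuotientGroup.mk x)))
  · rintro _ ⟨y, hy, rfl⟩
    exact ⟨σ y, hσL hy, rfl⟩
  · intro y
    induction y using QuotientGroup.induction_on with
    | H y => rw [← (hs.iterate_right n).eq, hσ]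

/-! ### Arithmetic of geometric sums. -/

/-- The geometric sum `1 + u + ⋯ + u ^ (p ^ j - 1)` is not divisible by `p ^ (j + 1)`. -/
theorem not_dvd_geom_sum_prime_pow {p u j : ℕ} (hp : p.Prime) (hp2 : p ≠ 2)
    (hu : u ≡ 1 [MOD p]) : ¬ p ^ (j + 1) ∣ ∑ i ∈ Finset.range (p ^ j), u ^ i := by
  have hu0 : u ≠ 0 := by
    rintro rfl
    have : p ∣ 1 := (Nat.modEq_zero_iff_dvd.1 hu.symm)
    exact hp.one_lt.ne' (Nat.dvd_one.1 this)
  rcases eq_or_ne u 1 with rfl | hu1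
  · simp only [one_pow, Finset.sum_const, Finset.card_range, smul_eq_mul, mul_one]
    rw [Nat.pow_dvd_pow_iff_le_right hp.one_lt]
    omega
  have hfact : Fact p.Prime := ⟨hp⟩
  have hdvd : p ∣ u - 1 := (Nat.modEq_iff_dvd' (by omega)).1 hu.symm
  have hpu : ¬ p ∣ u := by
    intro h
    have h1 := (Nat.dvd_sub_iff_right (by omega : 1 ≤ u) h).1 hdvd
    exact hp.one_lt.ne' (Nat.dvd_one.1 h1)
  -- Lifting the exponent: the sum has `p`-adic valuation exactly `j`.
  have h1 := Nat.emultiplicity_pow_sub_pow hp (hp.odd_of_ne_two hp2) hdvd hpu (p ^ j)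
  have h2 : (∑ i ∈ Finset.range (p ^ j), u ^ i) * (u - 1) = u ^ p ^ j - 1 ^ p ^ j := by
    rw [one_pow]; exact geom_sum_mul_of_one_le (Nat.one_le_iff_ne_zero.2 hu0) _
  have hfin : FiniteMultiplicity p (u - 1) :=
    Nat.finiteMultiplicity_iff.2 ⟨hp.ne_one, by omega⟩
  rw [← h2, emultiplicity_mul hp.prime, add_comm] at h1
  have h3 : emultiplicity p (∑ i ∈ Finset.range (p ^ j), u ^ i) = j := by
    have h4 := ENat.add_right_injective_of_ne_top
      (finiteMultiplicity_iff_emultiplicity_ne_top.1 hfin) h1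
    rw [h4, emultiplicity_pow_self hp.ne_zero hp.prime.not_isUnit]
  intro h
  have h5 := le_emultiplicity_of_pow_dvd h
  rw [h3] at h5
  have h6 : j + 1 ≤ j := by exact_mod_cast h5
  omega

theorem Nat.modEq_one_of_pow_prime_pow_modEq_one {p u n : ℕ} (hp : p.Prime)
    (h : u ^ p ^ n ≡ 1 [MOD p]) : u ≡ 1 [MOD p] := by
  have hfact : Fact p.Prime := ⟨hp⟩
  have h1 := (ZMod.natCast_eq_natCast_iff _ _ _).2 h
  rw [Nat.cast_pow, ZMod.pow_card_pow] at h1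
  exact (ZMod.natCast_eq_natCast_iff _ _ _).1 h1

/-! ### The lambda action and subgroups of `(G, ∘)`. -/

namespace SkewBrace

variable {G : Type u} [Group G] [SkewBrace G]

theorem toCirc_one : toCirc G 1 = 1 := by
  have h := toCirc_mul_toCirc_mul G 1 1 1
  have h2 : toCirc G 1 * toCirc G 1 = toCirc G 1 := by
    apply (toCirc G).symm.injective
    simp only [mul_one] at h
    have h3 : (toCirc G).symm (toCirc G 1 * toCirc G 1) = 1 := by simpa using h
    rw [h3, Equiv.symm_apply_apply]
  exact mul_eq_left.1 h2

/-- The action `a⁻¹ · (a ∘ b)` of `(G, ∘)` on `(G, ·)`. -/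
def lambdaFun (a b : G) : G := a⁻¹ * (toCirc G).symm (toCirc G a * toCirc G b)

theorem toCirc_mul (a b : G) : toCirc G a * toCirc G b = toCirc G (a * lambdaFun a b) := by
  simp [lambdaFun]

/-- The map `b ↦ a⁻¹ · (a ∘ b)` is an automorphism of the additive group. -/
def lambda (a : Circ G) : G ≃* G where
  toFun := lambdaFun ((toCirc G).symm a)
  invFun b := (toCirc G).symm (a⁻¹ * toCirc G ((toCirc G).symm a * b))
  left_inv b := by simp [lambdaFun]
  right_inv b := by simp [lambdaFun]
  map_mul' b c := by
    simp only [lambdaFun, toCirc_mul_toCirc_mul]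
    group

theorem toCirc_symm_mul (a b : Circ G) :
    (toCirc G).symm (a * b) = (toCirc G).symm a * lambda a ((toCirc G).symm b) := by
  simp [lambda, lambdaFun]

theorem lambda_mul (a b : Circ G) (x : G) : lambda (a * b) x = lambda a (lambda b x) := by
  have h := congrArg (toCirc G).symm (mul_assoc a b (toCirc G x))
  rw [toCirc_symm_mul (a * b), toCirc_symm_mul a b, toCirc_symm_mul a, toCirc_symm_mul b,
    Equiv.symm_apply_apply, map_mul, mul_assoc] at h
  exact mul_left_cancel (mul_left_cancel h)

theorem lambda_one (x : G) : lambda (1 : Circ G) x = x := by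
  have h := lambda_mul (1 : Circ G) 1 x
  rw [mul_one] at h
  exact (lambda (1 : Circ G)).injective h.symm

theorem lambda_pow (a : Circ G) (n : ℕ) (x : G) :
    lambda (a ^ n) x = (lambda a).toMonoidHom^[n] x := by
  induction n generalizing x with
  | zero => simp [lambda_one]
  | succ n ih => rw [pow_succ, lambda_mul, ih, Function.iterate_succ_apply]; rfl

theorem toCirc_symm_one : (toCirc G).symm 1 = 1 := by
  rw [Equiv.symm_apply_eq, toCirc_one]

theorem lambda_mem (S : Subgroup G) [hS : S.Characteristic] (a : Circ G) {x : G} (hx : x ∈ S) :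
    lambda a x ∈ S :=
  Subgroup.characteristic_iff_le_comap.1 hS (lambda a) hx

/-- A characteristic subgroup of the additive group, as a subgroup of `(G, ∘)`. -/
def circSubgroup (S : Subgroup G) [S.Characteristic] : Subgroup (Circ G) where
  carrier := {a | (toCirc G).symm a ∈ S}
  mul_mem' {a b} ha hb := by
    change (toCirc G).symm (a * b) ∈ S
    rw [toCirc_symm_mul]
    exact mul_mem ha (lambda_mem S a hb)
  one_mem' := by
    change (toCirc G).symm 1 ∈ S
    rw [toCirc_symm_one]; exact one_mem S
  inv_mem' {a} ha := by
    change (toCirc G).symm a⁻¹ ∈ S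
    have h := toCirc_symm_mul a⁻¹ a
    rw [inv_mul_cancel, toCirc_symm_one] at h
    rw [eq_inv_of_mul_eq_one_left h.symm]
    exact inv_mem (lambda_mem S _ ha)

theorem mem_circSubgroup (S : Subgroup G) [S.Characteristic] (a : Circ G) :
    a ∈ circSubgroup S ↔ (toCirc G).symm a ∈ S := Iff.rfl

theorem card_circSubgroup (S : Subgroup G) [S.Characteristic] :
    Nat.card (circSubgroup S) = Nat.card S := rfl

theorem isSubSkewBrace_of_characteristic (S : Subgroup G) [S.Characteristic] :
    IsSubSkewBrace S :=
  ⟨circSubgroup S, fun _ => Iff.rfl⟩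

/-- Powers for `∘` become additive powers with a geometric sum as exponent, which lets orders in the
two groups be compared. -/
theorem toCirc_symm_pow (a : Circ G) {w : ℕ}
    (hw : lambda a ((toCirc G).symm a) = (toCirc G).symm a ^ w) (n : ℕ) :
    (toCirc G).symm (a ^ n) = (toCirc G).symm a ^ ∑ i ∈ Finset.range n, w ^ i := by
  induction n with
  | zero => simp [toCirc_symm_one]
  | succ n ih =>
    rw [pow_succ', toCirc_symm_mul, ih, map_pow, hw, ← pow_mul, ← pow_succ', Finset.mul_sum,
      Finset.sum_range_succ']
    simp [pow_succ']

/-- A characteristic cyclic `r`-subgroup of the additive group, `r` odd, is cyclic for `∘`. -/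
theorem isCyclic_circSubgroup [Finite G] {r : ℕ} (hr : r.Prime) (hr2 : r ≠ 2) (S : Subgroup G)
    [S.Characteristic] [IsCyclic S] (hS : IsPGroup r S) : IsCyclic (circSubgroup S) := by
  have hfact : Fact r.Prime := ⟨hr⟩
  obtain ⟨n, hn⟩ := IsPGroup.iff_card.1 hS
  have hfinC : Finite (Circ G) := ‹Finite G›
  rcases n with _ | j
  · have : Nat.card (circSubgroup S) = 1 := by rw [card_circSubgroup, hn, pow_zero]
    have := (Nat.card_eq_one_iff_unique.1 this).1
    infer_instance
  obtain ⟨⟨g, hgS⟩, hg⟩ := IsCyclic.exists_ofOrder_eq_natCard (α := S)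
  rw [Subgroup.orderOf_mk, hn] at hg
  have hgen : Subgroup.zpowers g = S := by
    apply Subgroup.eq_of_le_of_card_ge (Subgroup.zpowers_le.2 hgS)
    rw [Nat.card_zpowers, hg, hn]
  obtain ⟨w, hw⟩ : ∃ w : ℕ, g ^ w = lambda (toCirc G g) g := by
    have := lambda_mem S (toCirc G g) hgS
    rw [← hgen] at this
    exact mem_powers_iff_mem_zpowers.2 this
  have hpow := toCirc_symm_pow (toCirc G g) (w := w) (by simpa using hw.symm)
  have hmem : toCirc G g ∈ circSubgroup S := (mem_circSubgroup _ _).2 (by simpa using hgS)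
  have hpow1 : (⟨toCirc G g, hmem⟩ : circSubgroup S) ^ r ^ (j + 1) = 1 := by
    rw [← hn, ← card_circSubgroup S, pow_card_eq_one']
  -- The `r ^ (j + 1)`-th iterate of `lambda` at `g` is trivial, so `w ^ r ^ (j + 1) ≡ 1`; modulo
  -- `r`, Frobenius removes the exponent.
  have hw1 : w ≡ 1 [MOD r] := by
    have h1 : toCirc G g ^ r ^ (j + 1) = 1 := congrArg Subtype.val hpow1
    have h2 := lambda_pow (toCirc G g) (r ^ (j + 1)) g
    rw [h1, lambda_one, MonoidHom.iterate_eq_pow (lambda (toCirc G g)).toMonoidHom hw.symm] at h2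
    have h3 : g ^ 1 = g ^ w ^ r ^ (j + 1) := by rw [pow_one]; exact h2
    rw [pow_eq_pow_iff_modEq, hg] at h3
    exact Nat.modEq_one_of_pow_prime_pow_modEq_one hr
      (h3.symm.of_dvd (dvd_pow_self r (Nat.succ_ne_zero j)))
  have hord : orderOf (⟨toCirc G g, hmem⟩ : circSubgroup S) = r ^ (j + 1) := by
    refine orderOf_eq_prime_pow ?_ hpow1
    intro h
    have h1 : toCirc G g ^ r ^ j = 1 := congrArg Subtype.val h
    have h2 := hpow (r ^ j)
    rw [h1, toCirc_symm_one, Equiv.symm_apply_apply] at h2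
    have h3 := orderOf_dvd_of_pow_eq_one h2.symm
    rw [hg] at h3
    exact not_dvd_geom_sum_prime_pow hr hr2 hw1 h3
  exact isCyclic_of_orderOf_eq_card _ (by rw [hord, card_circSubgroup, hn])

end SkewBrace

theorem Subgroup.isCoatom_of_index_prime {G : Type*} [Group G] (H : Subgroup G)
    (hH : H.index.Prime) : IsCoatom H := by
  refine ⟨fun h => hH.ne_one (Subgroup.index_eq_one.2 h), fun J hJ => ?_⟩
  rcases (Nat.dvd_prime hH).1 (Subgroup.index_dvd_of_le hJ.le) with h | h
  · exact Subgroup.index_eq_one.1 h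
  · have h1 := Subgroup.relIndex_mul_index hJ.le
    rw [h, Nat.mul_eq_right hH.ne_zero] at h1
    exact absurd (Subgroup.relIndex_eq_one.1 h1) hJ.not_ge

theorem Sylow.card_eq_pow_of_card_eq {G : Type*} [Group G] [Finite G] {p α m : ℕ} [Fact p.Prime]
    (hpm : p.Coprime m) (hG : Nat.card G = p ^ α * m) (P : Sylow p G) : Nat.card P = p ^ α := by
  have h1 : p ^ α ∣ Nat.card P := P.pow_dvd_card_of_pow_dvd_card (hG ▸ dvd_mul_right _ _)
  obtain ⟨b, hb⟩ := IsPGroup.iff_card.1 P.isPGroup'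
  refine Nat.dvd_antisymm ?_ h1
  have h2 : Nat.card P ∣ p ^ α * m := hG ▸ Subgroup.card_subgroup_dvd_card _
  rw [hb] at h2 ⊢
  exact (hpm.pow_left b).dvd_of_dvd_mul_right h2

namespace Subgroup

variable {G : Type*} [Group G] {H K : Subgroup G}

/-- Complementary normal subgroups give a direct product decomposition. -/
theorem IsComplement'.nonempty_mulEquiv_prod [H.Normal] [K.Normal] (h : H.IsComplement' K) :
    Nonempty (G ≃* H × K) := by
  refine ⟨(MulEquiv.ofBijective (MonoidHom.noncommCoprod H.subtype K.subtype ?_) ?_).symm⟩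
  · exact fun x y => Subgroup.commute_of_normal_of_disjoint H K inferInstance inferInstance
      h.disjoint x y x.2 y.2
  · exact h

end Subgroup

/-! ### The Hall and Sylow subgroups of `(G, ∘)`. -/

namespace SkewBrace

variable {G : Type u} [Group G] [SkewBrace G] [Finite G]

instance : Finite (Circ G) := ‹Finite G›

/-- The Sylow subgroups of `K` are characteristic in `G`, so they give cyclic Sylow subgroups for
`∘` as well. -/
theorem isZGroup_circSubgroup (K : Subgroup G) [K.Characteristic] [IsCyclic K]
    (hodd : ∀ r : ℕ, r.Prime → r ∣ Nat.card K → r ≠ 2) : IsZGroup (circSubgroup K) := by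
  refine ⟨fun r hr R => ?_⟩
  have hfact : Fact r.Prime := ⟨hr⟩
  by_cases hrK : r ∣ Nat.card K
  · obtain ⟨T⟩ : Nonempty (Sylow r K) := inferInstance
    have hchar := K.characteristic_map_sylow T
    have hS := (T.isPGroup'.map K.subtype)
    have hSK : (T : Subgroup K).map K.subtype ≤ K := Subgroup.map_subtype_le _
    have hScyc : IsCyclic ((T : Subgroup K).map K.subtype) :=
      isCyclic_of_injective (Subgroup.inclusion hSK) (Subgroup.inclusion_injective hSK)
    have hcyc := isCyclic_circSubgroup hr (hodd r hr hrK) _ hS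
    have hle : circSubgroup ((T : Subgroup K).map K.subtype) ≤ circSubgroup K :=
      fun a ha => hSK ha
    have hcard : Nat.card ((circSubgroup ((T : Subgroup K).map K.subtype)).subgroupOf
        (circSubgroup K)) = r ^ (Nat.card (circSubgroup K)).factorization r := by
      rw [Nat.card_congr (Subgroup.subgroupOfEquivOfLe hle).toEquiv, card_circSubgroup,
        card_circSubgroup, ← T.card_eq_multiplicity]
      exact Nat.card_congr
        ((T : Subgroup K).equivMapOfInjective K.subtype K.subtype_injective).symm.toEquiv
    have hcyc' : IsCyclic ((circSubgroup ((T : Subgroup K).map K.subtype)).subgroupOf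
        (circSubgroup K)) := (Subgroup.subgroupOfEquivOfLe hle).isCyclic.2 hcyc
    have e := Sylow.equiv R (Sylow.ofCard _ hcard)
    exact e.isCyclic.2 hcyc'
  · have h1 : Nat.card R = 1 := by
      rw [R.card_eq_multiplicity, card_circSubgroup, Nat.factorization_eq_zero_of_not_dvd hrK,
        pow_zero]
    have := (Nat.card_eq_one_iff_unique.1 h1).1
    infer_instance

theorem circSubgroup_normal {p α : ℕ} (hp : p.Prime) (K L : Subgroup G)
    [K.Characteristic] [L.Characteristic] [IsCyclic L] (hKL : K ≤ L)
    (hK : K.index = p ^ α) (hL : L.index = p)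
    (hm : ∀ q : ℕ, q.Prime → q ∣ Nat.card K → p < q) : (circSubgroup K).Normal := by
  suffices h : ∀ g ∈ circSubgroup K, ∀ h : Circ G, h⁻¹ * g * h ∈ circSubgroup K from
    ⟨fun g hg x => by simpa using h g hg x⁻¹⟩
  intro g hg h
  have hgm : g ^ Nat.card K = 1 := by
    have : (⟨g, hg⟩ : circSubgroup K) ^ Nat.card K = 1 := by
      rw [← card_circSubgroup K, pow_card_eq_one']
    exact congrArg Subtype.val this
  have h1 : ((toCirc G).symm h)⁻¹ * lambda g ((toCirc G).symm h) ∈ K :=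
    inv_mul_apply_mem_of_isCyclic hp hm Nat.card_pos.ne' K L hKL hK hL (lambda g).toMonoidHom
      (fun x hx => lambda_mem K g hx) (fun x hx => lambda_mem L g hx)
      (fun x => by rw [← lambda_pow, hgm, lambda_one]) _
  -- Expanding both sides additively, `lambda h` sends `h⁻¹ ∘ g ∘ h` to `(h⁻¹ · g · h) · (h⁻¹ ·
  -- lambda g h)`, with additive inverses in the latter; both factors lie in `K`.
  have h2 : (toCirc G).symm (h * (h⁻¹ * g * h)) = (toCirc G).symm (g * h) := by
    congr 1; group
  rw [toCirc_symm_mul h, toCirc_symm_mul g] at h2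
  have h3 : lambda h ((toCirc G).symm (h⁻¹ * g * h)) ∈ K := by
    rw [eq_inv_mul_of_mul_eq h2]
    have h4 := mul_mem ((inferInstance : K.Normal).conj_mem' ((toCirc G).symm g) hg
      ((toCirc G).symm h)) h1
    convert h4 using 1
    group
  have h5 := lambda_mem K h⁻¹ h3
  rwa [← lambda_mul, inv_mul_cancel, lambda_one] at h5

/-- If the additive group has a characteristic cyclic subgroup of index `p`, the Sylow
`p`-subgroups of `(G, ∘)` have a cyclic maximal subgroup. -/
theorem exists_sylow_hasCyclicMaximalSubgroup {p α m : ℕ} [Fact p.Prime] (hp2 : p ≠ 2)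
    (hpm : p.Coprime m) (hcard : Nat.card G = p ^ α * m) (L : Subgroup G) [L.Characteristic]
    [IsCyclic L] (hL : L.index = p) :
    ∃ Q : Sylow p (Circ G), HasCyclicMaximalSubgroup Q := by
  have hp : p.Prime := Fact.out
  obtain ⟨T⟩ : Nonempty (Sylow p L) := inferInstance
  have hchar := L.characteristic_map_sylow T
  have hS := (T.isPGroup'.map L.subtype)
  have hSL : (T : Subgroup L).map L.subtype ≤ L := Subgroup.map_subtype_le _
  have hScyc : IsCyclic ((T : Subgroup L).map L.subtype) :=
    isCyclic_of_injective (Subgroup.inclusion hSL) (Subgroup.inclusion_injective hSL)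
  have hcyc := isCyclic_circSubgroup hp hp2 _ hS
  have hSp : IsPGroup p (circSubgroup ((T : Subgroup L).map L.subtype)) := by
    obtain ⟨b, hb⟩ := IsPGroup.iff_card.1 hS
    exact IsPGroup.of_card (n := b) (by rw [card_circSubgroup, hb])
  obtain ⟨Q, hQ⟩ := hSp.exists_le_sylow
  refine ⟨Q, (circSubgroup ((T : Subgroup L).map L.subtype)).subgroupOf Q, ?_,
    (Subgroup.subgroupOfEquivOfLe hQ).isCyclic.2 hcyc⟩
  apply Subgroup.isCoatom_of_index_prime
  have hα : α ≠ 0 := by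
    rintro rfl
    have h1 : p ∣ m := by
      have := L.index_dvd_card
      rwa [hL, hcard, pow_zero, one_mul] at this
    exact (Nat.Prime.coprime_iff_not_dvd hp).1 hpm h1
  obtain ⟨β, rfl⟩ := Nat.exists_eq_succ_of_ne_zero hα
  have hLcard : Nat.card L = p ^ β * m := by
    have h1 := L.card_mul_index
    rw [hL, hcard, Nat.succ_eq_add_one, pow_succ, mul_right_comm] at h1
    exact Nat.eq_of_mul_eq_mul_right hp.pos h1
  have hT := Sylow.card_eq_pow_of_card_eq hpm hLcard T
  have hQc := Sylow.card_eq_pow_of_card_eq (G := Circ G) hpm hcard Q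
  have h2 := ((circSubgroup ((T : Subgroup L).map L.subtype)).subgroupOf
    (Q : Subgroup (Circ G))).card_mul_index
  rw [Nat.card_congr (Subgroup.subgroupOfEquivOfLe hQ).toEquiv, card_circSubgroup,
    ← Nat.card_congr
      ((T : Subgroup L).equivMapOfInjective L.subtype L.subtype_injective).toEquiv, hT, hQc,
    Nat.succ_eq_add_one, pow_succ] at h2
  rwa [Nat.eq_of_mul_eq_mul_left (pow_pos hp.pos β) h2]

end SkewBrace

/-! ### The main theorem. -/

theorem theorem6p6 {G : Type u} [Group G] [Finite G] [SkewBrace G]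
    (hmin : SkewBrace.IsMinimalNonCyclic G)
    (p α m : ℕ) (hp : p.Prime) (hp2 : 2 < p) (hα : 0 < α)
    (hm : ∀ q : ℕ, q.Prime → q ∣ m → p < q)
    (hcard : Nat.card G = p ^ α * m)
    (hnil : ¬ Group.IsNilpotent G)
    (hperf : ¬ Group.IsPerfect G) :
    (Group.IsNilpotent (SkewBrace.Circ G) ∧
      ∃ (Q : Type u) (_ : Group Q),
        IsPGroup p Q ∧ HasCyclicMaximalSubgroup Q ∧
        Nonempty (SkewBrace.Circ G ≃* Multiplicative (ZMod m) × Q)) ∨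
    (¬ Group.IsNilpotent (SkewBrace.Circ G) ∧
      ∃ (K Q : Type u) (_ : Group K) (_ : Group Q) (φ : Q →* MulAut K),
        IsZGroup K ∧ Nat.card K = m ∧
        IsPGroup p Q ∧ HasCyclicMaximalSubgroup Q ∧
        Nonempty (SkewBrace.Circ G ≃* K ⋊[φ] Q)) := by
  have hfact : Fact p.Prime := ⟨hp⟩
  have hpm := hp.coprime_of_forall_lt hm
  have hchar : ∀ S : Subgroup G, S.Characteristic → S ≠ ⊤ → IsCyclic S := fun S _ =>
    hmin.2 S (SkewBrace.isSubSkewBrace_of_characteristic S)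
  have hcomm : IsCyclic (commutator G) :=
    hchar _ inferInstance fun h => hperf (Group.isPerfect_def.2 h)
  obtain ⟨K, hKchar, hKcard, hKidx⟩ := exists_hall_of_isCyclic_commutator hp hm hcard
  have hKcyc : IsCyclic K := hchar K hKchar fun h => by
    rw [Subgroup.index_eq_one.2 h] at hKidx
    exact (Nat.one_lt_pow hα.ne' hp.one_lt).ne hKidx
  have hKm : ∀ q : ℕ, q.Prime → q ∣ Nat.card K → p < q := hKcard.symm ▸ hm
  obtain ⟨L, hLchar, hLcyc, hKL, hLidx⟩ :=
    exists_isCyclic_characteristic_index_eq hp hchar hnil K hKm hKidx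
  have hnormal := SkewBrace.circSubgroup_normal hp K L hKL hKidx hLidx hKm
  have hZ : IsZGroup (SkewBrace.circSubgroup K) := SkewBrace.isZGroup_circSubgroup K
    fun r hr hrK => (hp2.trans (hKm r hr hrK)).ne'
  obtain ⟨Q, hQ⟩ := SkewBrace.exists_sylow_hasCyclicMaximalSubgroup hp2.ne' hpm hcard L hLidx
  have hQcard := Sylow.card_eq_pow_of_card_eq (G := SkewBrace.Circ G) hpm hcard Q
  have hKcard' : Nat.card (SkewBrace.circSubgroup K) = m := hKcard
  have hcompl : (SkewBrace.circSubgroup K).IsComplement' (Q : Subgroup (SkewBrace.Circ G)) := by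
    apply Subgroup.isComplement'_of_coprime
    · rw [hKcard', hQcard, mul_comm]; exact hcard.symm
    · rw [hKcard', hQcard]; exact hpm.symm.pow_right α
  by_cases hN : Group.IsNilpotent (SkewBrace.Circ G)
  · left
    refine ⟨hN, Q, inferInstance, Q.isPGroup', hQ, ?_⟩
    -- The instance combines nilpotency, inherited by subgroups, with `hZ`.
    have hc : IsCyclic (SkewBrace.circSubgroup K) := inferInstance
    obtain ⟨e⟩ := hcompl.nonempty_mulEquiv_prod
    have e' := zmodCyclicMulEquiv hc
    rw [hKcard'] at e'
    exact ⟨e.trans (e'.symm.prodCongr (MulEquiv.refl _))⟩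
  · right
    exact ⟨hN, SkewBrace.circSubgroup K, Q, inferInstance, inferInstance, _, hZ, hKcard',
      Q.isPGroup', hQ, ⟨(SemidirectProduct.mulEquivSubgroup hcompl).symm⟩⟩
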